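/- Let $m,n\ge 2$ be integers, let $L$ be a field in which $m$ is invertible, and let $\chi_1,\dots,\chi_n\in L^\ast$. Let $X=X_{\chi_1,\dots,\chi_n}\subset\mathbb P^{2^n-1}_L$ be the hypersurface of degree $m$ (the Fermat–Pfister hypersurface) given by $$\sum_{\epsilon\in\{0,1\}^n}(-\chi_1)^{\epsilon_1}(-\chi_2)^{\epsilon_2}\cdots(-\chi_n)^{\epsilon_n}\cdot y_{\phi(\epsilon)}^m=0,\qquad \phi(\epsilon)=\sum_{i=1}^n\epsilon_i\,2^{i-1},$$ where $y_0,\dots,y_{2^n-1}$ are the homogeneous coordinates. Then $X$ is smooth over $L$. Moreover, let $Y$ be a variety over $L$ (an integral separated scheme of finite type over $L$) which admits a morphism $\iota:Y\to X$ of $L$-schemes. Then $$(\chi_1,\dots,\chi_n)\in\ker\left(K^M_n(L)/m\longrightarrow K^M_n(L(Y))/m\right),$$ where $L(Y)$ is the function field of $Y$, $K^M_n(F)$ is the $n$-th Milnor K-group of a field $F$, i.e. the quotient of $(F^\ast)^{\otimes n}$ (tensor power over $\mathbb Z$) by the subgroup generated by the tensors $a_1\otimes\cdots\otimes a_n$ with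 $a_i+a_{i+1}=1$ for some $1\le i\le n-1$, and $(\chi_1,\dots,\chi_n)$ is the class of $\chi_1\otimes\cdots\otimes\chi_n$. -/

import Mathlib

open CategoryTheory AlgebraicGeometry
open scoped TensorProduct DirectSum

universe u v

noncomputable section

/-! ## Milnor K-theory -/

/-- The `n`-fold tensor power over `ℤ` of the group of units of `R`. -/
abbrev UnitsTensorPower (R : Type u) [CommRing R] (n : ℕ) : Type u :=
  ⨂[ℤ] _ : Fin n, Additive Rˣ

/-- The pure tensor `a₁ ⊗ ⋯ ⊗ aₙ`. -/
def unitsTprod {R : Type u} [CommRing R] {n : ℕ} (a : Fin n → Rˣ) : UnitsTensorPower R n :=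
  PiTensorProduct.tprod ℤ (fun i => Additive.ofMul (a i))

/-- The subgroup generated by the tensors `a₁ ⊗ ⋯ ⊗ aₙ` with `aᵢ + aᵢ₊₁ = 1` for some `i`. -/
def steinbergRelations (R : Type u) [CommRing R] (n : ℕ) : Submodule ℤ (UnitsTensorPower R n) :=
  Submodule.span ℤ {t | ∃ (a : Fin n → Rˣ) (i j : Fin n),
    (j : ℕ) = (i : ℕ) + 1 ∧ (a i : R) + (a j : R) = 1 ∧ t = unitsTprod a}

/-- The Milnor K-group `K_n^M(R)`. -/
abbrev MilnorK (R : Type u) [CommRing R] (n : ℕ) : Type u :=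
  UnitsTensorPower R n ⧸ steinbergRelations R n

/-- `K_n^M(R)/m`, the quotient of `K_n^M(R)` by its `m`-th multiples. -/
abbrev MilnorKMod (R : Type u) [CommRing R] (n m : ℕ) : Type u :=
  MilnorK R n ⧸ LinearMap.range (LinearMap.lsmul ℤ (MilnorK R n) (m : ℤ))

/-- The symbol `(a₁, …, aₙ)` in `K_n^M(R)/m`. -/
def milnorSymbol {R : Type u} [CommRing R] {n : ℕ} (m : ℕ) (a : Fin n → Rˣ) :
    MilnorKMod R n m :=
  Submodule.Quotient.mk (Submodule.Quotient.mk (unitsTprod a))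

/-- The map on tensor powers of unit groups induced by a ring homomorphism. -/
def unitsTensorPowerMap {R : Type u} {S : Type v} [CommRing R] [CommRing S] (f : R →+* S) (n : ℕ) :
    UnitsTensorPower R n →ₗ[ℤ] UnitsTensorPower S n :=
  PiTensorProduct.map
    (fun _ => (MonoidHom.toAdditive (Units.map (f : R →* S))).toIntLinearMap)

theorem unitsTensorPowerMap_tprod {R : Type u} {S : Type v} [CommRing R] [CommRing S]
    (f : R →+* S) {n : ℕ} (a : Fin n → Rˣ) :
    unitsTensorPowerMap f n (unitsTprod a) =
      unitsTprod (fun i => Units.map (f : R →* S) (a i)) := by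
  simp only [unitsTensorPowerMap, unitsTprod, PiTensorProduct.map_tprod]
  rfl

theorem steinbergRelations_le_comap {R : Type u} {S : Type v} [CommRing R] [CommRing S]
    (f : R →+* S) (n : ℕ) :
    steinbergRelations R n ≤ (steinbergRelations S n).comap (unitsTensorPowerMap f n) := by
  refine Submodule.span_le.2 ?_
  rintro t ⟨a, i, j, hij, h, rfl⟩
  refine Submodule.subset_span
    ⟨fun i => Units.map (f : R →* S) (a i), i, j, hij, ?_, unitsTensorPowerMap_tprod f a⟩
  simpa using congrArg f h

/-- The homomorphism `K_n^M(R) → K_n^M(S)` induced by a ring homomorphism `R → S`. -/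
def milnorKMap {R : Type u} {S : Type v} [CommRing R] [CommRing S] (f : R →+* S) (n : ℕ) :
    MilnorK R n →ₗ[ℤ] MilnorK S n :=
  Submodule.mapQ _ _ (unitsTensorPowerMap f n) (steinbergRelations_le_comap f n)

/-- The homomorphism `K_n^M(R)/m → K_n^M(S)/m` induced by a ring homomorphism `R → S`. -/
def milnorKModMap {R : Type u} {S : Type v} [CommRing R] [CommRing S] (f : R →+* S) (n m : ℕ) :
    MilnorKMod R n m →ₗ[ℤ] MilnorKMod S n m :=
  Submodule.mapQ _ _ (milnorKMap f n) (by
    rintro _ ⟨x, rfl⟩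
    exact ⟨milnorKMap f n x, by simp⟩)

theorem milnorKModMap_symbol {R : Type u} {S : Type v} [CommRing R] [CommRing S] (f : R →+* S)
    {n : ℕ} (m : ℕ) (a : Fin n → Rˣ) :
    milnorKModMap f n m (milnorSymbol m a) =
      milnorSymbol m (fun i => Units.map (f : R →* S) (a i)) := by
  simp only [milnorKModMap, milnorKMap, milnorSymbol, ← unitsTensorPowerMap_tprod]
  rfl

/-! ## The graded quotient of a graded algebra by a homogeneous ideal -/

section GradedQuotient

variable {k A : Type u} [CommRing k] [CommRing A] [Algebra k A]
  (𝒜 : ℕ → Submodule k A) [GradedAlgebra 𝒜] (I : HomogeneousIdeal 𝒜)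

/-- The grading on `A ⧸ I`: the degree `i` part is the image of the degree `i` part of `A`. -/
def quotientGrading (i : ℕ) : Submodule k (A ⧸ I.toIdeal) :=
  (𝒜 i).map (Ideal.Quotient.mkₐ k I.toIdeal).toLinearMap

instance quotientGrading.gradedMonoid : SetLike.GradedMonoid (quotientGrading 𝒜 I) where
  one_mem := ⟨1, SetLike.one_mem_graded 𝒜, by simp⟩
  mul_mem := by
    rintro i j _ _ ⟨a, ha, rfl⟩ ⟨b, hb, rfl⟩
    exact ⟨a * b, SetLike.mul_mem_graded ha hb, by simp⟩

/-- The projection `A_i → (A ⧸ I)_i`. -/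
def quotientGrading.proj (i : ℕ) : 𝒜 i →ₗ[k] quotientGrading 𝒜 I i :=
  ((Ideal.Quotient.mkₐ k I.toIdeal).toLinearMap.comp (𝒜 i).subtype).codRestrict _
    (fun x => ⟨x, x.2, rfl⟩)

/-- The map `A → ⨁ i, (A ⧸ I)_i` sending `a` to the classes of its homogeneous components. -/
def quotientGrading.components : A →ₐ[k] ⨁ i, quotientGrading 𝒜 I i :=
  (DirectSum.toAlgebra k (fun i => 𝒜 i)
    (fun i => (DirectSum.lof k ℕ (fun i => quotientGrading 𝒜 I i) i).comp
      (quotientGrading.proj 𝒜 I i))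
    (by rfl)
    (by
      intro i j a b
      simp only [LinearMap.comp_apply, DirectSum.lof_eq_of, DirectSum.of_mul_of]
      rfl)).comp (DirectSum.decomposeAlgEquiv 𝒜).toAlgHom

theorem quotientGrading.components_of_mem {i : ℕ} {a : A} (ha : a ∈ 𝒜 i) :
    quotientGrading.components 𝒜 I a =
      DirectSum.of (fun i => quotientGrading 𝒜 I i) i ⟨Ideal.Quotient.mk _ a, ⟨a, ha, rfl⟩⟩ := by
  have : DirectSum.decomposeAlgEquiv 𝒜 a = DirectSum.of (fun i => 𝒜 i) i ⟨a, ha⟩ :=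
    DirectSum.decompose_of_mem 𝒜 ha
  simp only [quotientGrading.components, AlgHom.comp_apply]
  erw [this, DirectSum.toAlgebra_apply, DirectSum.toSemiring_of]
  rfl

theorem quotientGrading.components_eq_zero {a : A} (ha : a ∈ I.toIdeal) :
    quotientGrading.components 𝒜 I a = 0 := by
  classical
  conv_lhs => rw [← DirectSum.sum_support_decompose 𝒜 a]
  rw [map_sum]
  refine Finset.sum_eq_zero fun i _ => ?_
  rw [quotientGrading.components_of_mem 𝒜 I (DirectSum.decompose 𝒜 a i).2]
  have h : (⟨Ideal.Quotient.mk _ (DirectSum.decompose 𝒜 a i : A),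
      ⟨_, (DirectSum.decompose 𝒜 a i).2, rfl⟩⟩ : quotientGrading 𝒜 I i) = 0 :=
    Subtype.ext (Ideal.Quotient.eq_zero_iff_mem.2 (I.isHomogeneous i ha))
  rw [h, map_zero]

instance quotientGrading.gradedAlgebra : GradedAlgebra (quotientGrading 𝒜 I) :=
  GradedAlgebra.ofAlgHom _
    (Ideal.Quotient.liftₐ I.toIdeal (quotientGrading.components 𝒜 I)
      (fun _ ha => quotientGrading.components_eq_zero 𝒜 I ha))
    (by
      classical
      refine AlgHom.ext fun x => ?_
      obtain ⟨a, rfl⟩ := Ideal.Quotient.mk_surjective x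
      change DirectSum.coeAlgHom (quotientGrading 𝒜 I) (quotientGrading.components 𝒜 I a) =
        Ideal.Quotient.mk _ a
      induction a using DirectSum.Decomposition.inductionOn 𝒜 with
      | zero => simp
      | homogeneous a =>
        rw [quotientGrading.components_of_mem 𝒜 I a.2, DirectSum.coeAlgHom_of]
      | add a b ha hb => rw [map_add, map_add, map_add, ha, hb])
    (by
      rintro i ⟨_, a, ha, rfl⟩
      exact quotientGrading.components_of_mem 𝒜 I ha)

/-- The closed subscheme `V₊(I) = Proj (A ⧸ I)` of `Proj A`. -/
def projZeroLocus : Scheme.{u} :=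
  Proj (quotientGrading 𝒜 I)

/-- The structure morphism `V₊(I) ⟶ Spec k`. -/
def projZeroLocus.toSpec : projZeroLocus 𝒜 I ⟶ Spec (CommRingCat.of k) :=
  Proj.toSpecZero (quotientGrading 𝒜 I) ≫
    Spec.map (CommRingCat.ofHom (algebraMap k (quotientGrading 𝒜 I 0)))

end GradedQuotient

/-! ## Fermat–Pfister hypersurfaces -/

attribute [local instance] MvPolynomial.gradedAlgebra

/-- The Fermat–Pfister form of degree `m` with coefficients `∏ i, (-χ i) ^ ε i`; the variable
attached to `ε` has index `φ ε = ∑ i, ε i * 2 ^ i` (with `i` starting from `0`), which is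
`finFunctionFinEquiv ε`. -/
def fermatPfisterForm {L : Type u} [Field L] (m n : ℕ) (χ : Fin n → Lˣ) :
    MvPolynomial (Fin (2 ^ n)) L :=
  ∑ ε : Fin n → Fin 2,
    MvPolynomial.C (∏ i, (-(χ i : L)) ^ (ε i : ℕ)) *
      MvPolynomial.X (finFunctionFinEquiv ε) ^ m

theorem fermatPfisterForm_isHomogeneous {L : Type u} [Field L] (m n : ℕ) (χ : Fin n → Lˣ) :
    (fermatPfisterForm m n χ).IsHomogeneous m :=
  MvPolynomial.IsHomogeneous.sum _ _ _ fun _ _ =>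
    MvPolynomial.isHomogeneous_C_mul_X_pow _ _ m

/-- The homogeneous ideal generated by the Fermat–Pfister form. -/
def fermatPfisterIdeal {L : Type u} [Field L] (m n : ℕ) (χ : Fin n → Lˣ) :
    HomogeneousIdeal (MvPolynomial.homogeneousSubmodule (Fin (2 ^ n)) L) where
  toSubmodule := Ideal.span {fermatPfisterForm m n χ}
  is_homogeneous' := Ideal.homogeneous_span _ _ (by
    rintro _ rfl
    exact ⟨m, fermatPfisterForm_isHomogeneous m n χ⟩)

/-- The hypersurface in the projective space of dimension `2 ^ n - 1` over `L` that is cut out by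
the Fermat–Pfister form. -/
def fermatPfisterHypersurface {L : Type u} [Field L] (m n : ℕ) (χ : Fin n → Lˣ) : Scheme.{u} :=
  projZeroLocus (MvPolynomial.homogeneousSubmodule (Fin (2 ^ n)) L) (fermatPfisterIdeal m n χ)

/-- The structure morphism of the Fermat–Pfister hypersurface. -/
def fermatPfisterHypersurface.toSpec {L : Type u} [Field L] (m n : ℕ) (χ : Fin n → Lˣ) :
    fermatPfisterHypersurface m n χ ⟶ Spec (CommRingCat.of L) :=
  projZeroLocus.toSpec _ (fermatPfisterIdeal m n χ)

/-! ## Function fields -/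

/-- The inclusion `L → L(Y)` of the base field into the function field of an irreducible scheme
`Y` over `L`: a scalar is pulled back to a global function on `Y`, and then restricted to the
generic point. -/
def toFunctionField {L : Type u} [Field L] {Y : Scheme.{u}} [IrreducibleSpace Y]
    (f : Y ⟶ Spec (CommRingCat.of L)) : L →+* Y.functionField :=
  ((Scheme.ΓSpecIso (CommRingCat.of L)).inv ≫ f.appTop ≫
    Y.presheaf.germ ⊤ (genericPoint Y) trivial).hom

end

/-!
Smoothness. The chart `x_i ≠ 0` of a diagonal hypersurface `∑ j, c_j x_j ^ m = 0` has as coordinate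
ring the homogeneous coordinate ring modulo `x_i - 1`. If `m` and `c_i` are invertible, this chart
is formally smooth: a solution modulo a square-zero ideal lifts, since by homogeneity the error is
cancelled when all coordinates except the `i`-th are scaled by a suitable factor `1 + t`.

Symbols. The generic point of `Y` gives a nontrivial zero over `L(Y)` of the Fermat–Pfister form of
`χ_1, …, χ_n`, which is `A - χ_n B` with `A` and `B` values of the form of `χ_1, …, χ_{n-1}`.
By induction on `n`, `(χ_1, …, χ_n, w) = 0` for each nonzero value `w` of the form: if
`w = A - χ_n B` with `A, B ≠ 0`, this is the Steinberg relation for `χ_n B / A + w / A = 1`, because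
the symbols `(χ_1, …, χ_{n-1}, A)` and `(χ_1, …, χ_{n-1}, B)` vanish. At a zero with `B ≠ 0` we have
`χ_n = A / B`, hence `(χ_1, …, χ_n) = 0`; at one with `A = B = 0`, already
`(χ_1, …, χ_{n-1}) = 0` by induction.
-/

noncomputable section

/-! ## Symbols in Milnor K-theory modulo `m` -/

section Snoc

variable (R : Type u) [CommRing R] (n m : ℕ)

/-- The multiplication `(Rˣ)^{⊗ n} × Rˣ → (Rˣ)^{⊗ (n + 1)}` of the tensor algebra. -/
def unitsTensorPowerSnoc :
    UnitsTensorPower R n →ₗ[ℤ] Additive Rˣ →ₗ[ℤ] UnitsTensorPower R (n + 1) :=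
  PiTensorProduct.lift
    (MultilinearMap.curryRight (M := fun _ => Additive Rˣ) (PiTensorProduct.tprod ℤ))

variable {R n} in
theorem unitsTensorPowerSnoc_tprod (a : Fin n → Rˣ) (x : Rˣ) :
    unitsTensorPowerSnoc R n (unitsTprod a) (Additive.ofMul x) =
      unitsTprod (Fin.snoc (α := fun _ => Rˣ) a x) := by
  rw [unitsTensorPowerSnoc, unitsTprod, PiTensorProduct.lift.tprod, MultilinearMap.curryRight_apply]
  rfl

theorem unitsTensorPowerSnoc_mem_steinbergRelations {t : UnitsTensorPower R n}
    (ht : t ∈ steinbergRelations R n) (x : Additive Rˣ) :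
    unitsTensorPowerSnoc R n t x ∈ steinbergRelations R (n + 1) := by
  suffices steinbergRelations R n ≤
      (steinbergRelations R (n + 1)).comap ((unitsTensorPowerSnoc R n).flip x) from this ht
  refine Submodule.span_le.2 ?_
  rintro _ ⟨a, i, j, hij, h, rfl⟩
  refine Submodule.subset_span ⟨_, i.castSucc, j.castSucc, by simpa using hij, ?_,
    unitsTensorPowerSnoc_tprod a x.toMul⟩
  simpa using h

/-- The multiplication `K_n^M(R) × K_1^M(R) → K_{n + 1}^M(R)`. -/
def milnorKSnoc : MilnorK R n →ₗ[ℤ] Additive Rˣ →ₗ[ℤ] MilnorK R (n + 1) :=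
  Submodule.liftQ _ ((unitsTensorPowerSnoc R n).compr₂ (steinbergRelations R (n + 1)).mkQ)
    fun _ ht => LinearMap.ext fun x => (Submodule.Quotient.mk_eq_zero _).2
      (unitsTensorPowerSnoc_mem_steinbergRelations R n ht x)

/-- The multiplication `K_n^M(R)/m × K_1^M(R) → K_{n + 1}^M(R)/m`. -/
def milnorKModSnoc : MilnorKMod R n m →ₗ[ℤ] Additive Rˣ →ₗ[ℤ] MilnorKMod R (n + 1) m :=
  Submodule.liftQ _ ((milnorKSnoc R n).compr₂ (Submodule.mkQ _)) (by
    rintro _ ⟨t, rfl⟩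
    refine LinearMap.ext fun x => (Submodule.Quotient.mk_eq_zero _).2 ⟨milnorKSnoc R n t x, ?_⟩
    simp only [LinearMap.lsmul_apply, map_smul, LinearMap.smul_apply])

variable {R n}

theorem milnorSymbol_snoc (a : Fin n → Rˣ) (x : Rˣ) :
    milnorSymbol m (Fin.snoc (α := fun _ => Rˣ) a x) =
      milnorKModSnoc R n m (milnorSymbol m a) (Additive.ofMul x) := by
  rw [milnorSymbol, ← unitsTensorPowerSnoc_tprod]
  rfl

variable {m} in
theorem milnorSymbol_snoc_eq_zero {a : Fin n → Rˣ} (ha : milnorSymbol m a = 0) (x : Rˣ) :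
    milnorSymbol m (Fin.snoc (α := fun _ => Rˣ) a x) = 0 := by
  rw [milnorSymbol_snoc, ha, map_zero, LinearMap.zero_apply]

theorem nsmul_milnorKMod (x : MilnorKMod R n m) : m • x = 0 := by
  obtain ⟨y, rfl⟩ := Submodule.Quotient.mk_surjective _ x
  rw [← Submodule.Quotient.mk_smul, Submodule.Quotient.mk_eq_zero]
  exact ⟨y, by simp⟩

theorem milnorSymbol_snoc_snoc_eq_zero (a : Fin n → Rˣ) {x y : Rˣ} (hxy : (x : R) + y = 1) :
    milnorSymbol m (Fin.snoc (α := fun _ => Rˣ) (Fin.snoc (α := fun _ => Rˣ) a x) y) = 0 := by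
  have h : unitsTprod (Fin.snoc (α := fun _ => Rˣ) (Fin.snoc (α := fun _ => Rˣ) a x) y) ∈
      steinbergRelations R (n + 2) :=
    Submodule.subset_span ⟨_, (Fin.last n).castSucc, Fin.last (n + 1), by simp, by simpa using hxy,
      rfl⟩
  rw [milnorSymbol, (Submodule.Quotient.mk_eq_zero _).2 h, Submodule.Quotient.mk_zero]

end Snoc

/-- A bimultiplicative map on the units of `R`, written additively, is a Steinberg symbol if it
kills all pairs of units with sum `1`. -/
def IsSteinbergSymbol {R G : Type*} [CommRing R] [AddCommGroup G]
    (S : Additive Rˣ →ₗ[ℤ] Additive Rˣ →ₗ[ℤ] G) : Prop :=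
  ∀ x y : Rˣ, (x : R) + y = 1 → S (.ofMul x) (.ofMul y) = 0

theorem isSteinbergSymbol_milnorKModSnoc {R : Type u} [CommRing R] (m : ℕ) {n : ℕ}
    (a : Fin n → Rˣ) :
    IsSteinbergSymbol (milnorKModSnoc R (n + 1) m ∘ₗ milnorKModSnoc R n m (milnorSymbol m a)) :=
  fun x y hxy => by
    rw [LinearMap.comp_apply, ← milnorSymbol_snoc, ← milnorSymbol_snoc,
      milnorSymbol_snoc_snoc_eq_zero m a hxy]

namespace IsSteinbergSymbol

variable {F G : Type*} [Field F] [AddCommGroup G] {S : Additive Fˣ →ₗ[ℤ] Additive Fˣ →ₗ[ℤ] G}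

theorem apply_neg (hS : IsSteinbergSymbol S) (x : Fˣ) : S (.ofMul x) (.ofMul (-x)) = 0 := by
  obtain rfl | hx := eq_or_ne x 1
  · rw [ofMul_one, map_zero, LinearMap.zero_apply]
  have sub_ne_zero_of_ne_one {z : Fˣ} (hz : z ≠ 1) : 1 - (z : F) ≠ 0 :=
    fun h => hz (Units.ext (sub_eq_zero.1 h).symm)
  let u := Units.mk0 _ (sub_ne_zero_of_ne_one hx)
  let v := Units.mk0 _ (sub_ne_zero_of_ne_one (inv_ne_one.2 hx))
  have hxu : S (.ofMul x) (.ofMul u) = 0 := hS _ _ (by simp [u])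
  have hxv : S (.ofMul x⁻¹) (.ofMul v) = 0 := hS _ _ (by simp [v])
  have hneg : -x = u * v⁻¹ := by
    rw [eq_mul_inv_iff_mul_eq]
    ext
    simp only [u, v, Units.val_mul, Units.val_neg, Units.val_mk0, mul_sub, mul_one, neg_mul,
      Units.mul_inv]
    ring
  rw [ofMul_inv, map_neg, LinearMap.neg_apply, neg_eq_zero] at hxv
  rw [hneg, ofMul_mul, ofMul_inv, map_add, map_neg, hxu, hxv, neg_zero, add_zero]

theorem apply_swap (hS : IsSteinbergSymbol S) (x y : Fˣ) :
    S (.ofMul x) (.ofMul y) = -S (.ofMul y) (.ofMul x) := by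
  have h := hS.apply_neg (x * y)
  have hx : S (.ofMul x) (.ofMul (-(x * y))) = S (.ofMul x) (.ofMul y) := by
    rw [← neg_mul, ofMul_mul, map_add, hS.apply_neg, zero_add]
  have hy : S (.ofMul y) (.ofMul (-(x * y))) = S (.ofMul y) (.ofMul x) := by
    rw [← mul_neg, ofMul_mul, map_add, hS.apply_neg, add_zero]
  rw [ofMul_mul, map_add, LinearMap.add_apply, hx, hy] at h
  exact eq_neg_of_add_eq_zero_left h

theorem apply_eq_zero_of_eq_sub_mul (hS : IsSteinbergSymbol S) {A B : F}
    (hA : ∀ u : Fˣ, (u : F) = A → S (.ofMul u) = 0)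
    (hB : ∀ u : Fˣ, (u : F) = B → S (.ofMul u) = 0) {x w : Fˣ} (hw : (w : F) = A - x * B) :
    S (.ofMul x) (.ofMul w) = 0 := by
  obtain rfl | hA0 := eq_or_ne A 0
  · have hB0 : B ≠ 0 := by
      rintro rfl
      exact w.ne_zero (by simp [hw])
    have hwB : w = -x * Units.mk0 B hB0 := by
      ext
      simp [hw]
    rw [hwB, ofMul_mul, map_add, hS.apply_neg, hS.apply_swap, hB _ rfl, LinearMap.zero_apply,
      neg_zero, add_zero]
  obtain rfl | hB0 := eq_or_ne B 0
  · rw [hS.apply_swap, hA w (by simp [hw]), LinearMap.zero_apply, neg_zero]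
  let a := Units.mk0 A hA0
  let b := Units.mk0 B hB0
  -- Dividing `w = A - x B` by `A` gives the Steinberg pair `x B / A + w / A = 1`.
  have h : S (.ofMul (x * b * a⁻¹)) (.ofMul (w * a⁻¹)) = 0 := by
    refine hS _ _ ?_
    simp only [a, b, Units.val_mul, Units.val_inv_eq_inv_val, hw, Units.val_mk0]
    field_simp
    ring
  have hxa : S (.ofMul x) (.ofMul a) = 0 := by
    rw [hS.apply_swap, hA a rfl, LinearMap.zero_apply, neg_zero]
  simpa only [ofMul_mul, ofMul_inv, map_add, map_neg, hA a rfl, hB b rfl, neg_zero, add_zero,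
    hxa] using h

end IsSteinbergSymbol

/-! ## Zeros of Fermat–Pfister forms and symbols -/

/-- The value at `y` of the Fermat–Pfister form of degree `m` with coefficients
`∏ i, (-χ i) ^ ε i`, where coordinates are indexed by `ε` itself. -/
def fermatPfisterValue {R : Type*} [CommRing R] (m : ℕ) {n : ℕ} (χ : Fin n → Rˣ)
    (y : (Fin n → Fin 2) → R) : R :=
  ∑ ε : Fin n → Fin 2, (∏ i, (-(χ i : R)) ^ (ε i : ℕ)) * y ε ^ m

theorem fermatPfisterValue_zero {R : Type*} [CommRing R] (m : ℕ) (χ : Fin 0 → Rˣ)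
    (y : (Fin 0 → Fin 2) → R) : fermatPfisterValue m χ y = y default ^ m := by
  rw [fermatPfisterValue, Fintype.sum_unique, Fin.prod_univ_zero, one_mul]
  exact congrArg (y · ^ m) (Subsingleton.elim _ _)

theorem fermatPfisterValue_snoc {R : Type*} [CommRing R] (m : ℕ) {n : ℕ} (χ : Fin n → Rˣ) (x : Rˣ)
    (y : (Fin (n + 1) → Fin 2) → R) :
    fermatPfisterValue m (Fin.snoc (α := fun _ => Rˣ) χ x) y =
      fermatPfisterValue m χ (fun ε => y (Fin.snoc ε 0)) -
        x * fermatPfisterValue m χ (fun ε => y (Fin.snoc ε 1)) := by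
  simp only [fermatPfisterValue]
  rw [← (Fin.snocEquiv fun _ : Fin (n + 1) => Fin 2).sum_comp, Fintype.sum_prod_type,
    Fin.sum_univ_two, Finset.mul_sum, sub_eq_add_neg, ← Finset.sum_neg_distrib]
  simp only [Fin.snocEquiv, Equiv.coe_fn_mk, Fin.prod_univ_castSucc, Fin.snoc_castSucc,
    Fin.snoc_last, Fin.val_zero, Fin.val_one, pow_zero, pow_one, mul_one]
  congr 1
  exact Finset.sum_congr rfl fun ε _ => by ring

section Field

variable {F : Type u} [Field F] {m : ℕ}

theorem milnorSymbol_snoc_fermatPfisterValue (hm : m ≠ 0) {n : ℕ} (χ : Fin n → Fˣ)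
    (y : (Fin n → Fin 2) → F) (w : Fˣ) (hw : (w : F) = fermatPfisterValue m χ y) :
    milnorSymbol m (Fin.snoc (α := fun _ => Fˣ) χ w) = 0 := by
  induction χ using Fin.snocInduction generalizing w with
  | elim0 =>
    rw [fermatPfisterValue_zero] at hw
    have hy : y default ≠ 0 := fun h => w.ne_zero (by rw [hw, h, zero_pow hm])
    obtain rfl : w = Units.mk0 _ hy ^ m := Units.ext hw
    rw [milnorSymbol_snoc, ofMul_pow, map_nsmul, nsmul_milnorKMod]
  | snoc χ x ih =>
    have hkill (y') (u : Fˣ) (hu : (u : F) = fermatPfisterValue m χ y') :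
        (milnorKModSnoc F _ m ∘ₗ milnorKModSnoc F _ m (milnorSymbol m χ)) (.ofMul u) = 0 := by
      rw [LinearMap.comp_apply, ← milnorSymbol_snoc, ih y' u hu, map_zero]
    rw [milnorSymbol_snoc, milnorSymbol_snoc]
    exact (isSteinbergSymbol_milnorKModSnoc m χ).apply_eq_zero_of_eq_sub_mul (hkill _) (hkill _)
      (hw.trans (fermatPfisterValue_snoc m χ x y))

theorem milnorSymbol_eq_zero_of_fermatPfisterValue_eq_zero (hm : m ≠ 0) {n : ℕ} (χ : Fin n → Fˣ)
    {y : (Fin n → Fin 2) → F} (hy : y ≠ 0) (h : fermatPfisterValue m χ y = 0) :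
    milnorSymbol m χ = 0 := by
  induction χ using Fin.snocInduction with
  | elim0 =>
    rw [fermatPfisterValue_zero] at h
    refine absurd (funext fun ε => ?_) hy
    rw [Subsingleton.elim ε default, eq_zero_of_pow_eq_zero h, Pi.zero_apply]
  | @snoc n χ x ih =>
    rw [fermatPfisterValue_snoc, sub_eq_zero] at h
    set y₀ := fun ε : Fin n → Fin 2 => y (Fin.snoc ε 0)
    set y₁ := fun ε : Fin n → Fin 2 => y (Fin.snoc ε 1)
    by_cases h₁ : fermatPfisterValue m χ y₁ = 0
    · have h₀ : fermatPfisterValue m χ y₀ = 0 := by rw [h, h₁, mul_zero]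
      refine milnorSymbol_snoc_eq_zero ?_ x
      by_contra hχ
      have hy₀' : y₀ = 0 := by_contra fun hne => hχ (ih hne h₀)
      have hy₁' : y₁ = 0 := by_contra fun hne => hχ (ih hne h₁)
      refine hy (funext fun ε => ?_)
      induction ε using Fin.snocCases with
      | _ ε e =>
        fin_cases e
        exacts [congrFun hy₀' ε, congrFun hy₁' ε]
    · have h₀ : fermatPfisterValue m χ y₀ ≠ 0 := h ▸ mul_ne_zero x.ne_zero h₁
      have hx : x = Units.mk0 _ h₀ * (Units.mk0 _ h₁)⁻¹ := by
        rw [eq_mul_inv_iff_mul_eq]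
        exact Units.ext h.symm
      rw [hx, milnorSymbol_snoc, ofMul_mul, ofMul_inv, map_add, map_neg, ← milnorSymbol_snoc,
        ← milnorSymbol_snoc, milnorSymbol_snoc_fermatPfisterValue hm χ y₀ _ rfl,
        milnorSymbol_snoc_fermatPfisterValue hm χ y₁ _ rfl, neg_zero, add_zero]

end Field

open HomogeneousLocalization

/-! ## Dehomogenization -/

section Dehomogenize

variable {k A : Type*} [CommRing k] [CommRing A] [Algebra k A] (𝒜 : ℕ → Submodule k A)
  [GradedAlgebra 𝒜] {f : A}

/-- The homogeneous localization `A_(f)` of a graded `k`-algebra as a `k`-algebra, with structure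
map through the degree-zero part of `A`. -/
instance awayAlgebra : Algebra k (Away 𝒜 f) where
  algebraMap := (fromZeroRingHom 𝒜 _).comp (algebraMap k (𝒜 0))
  commutes' _ _ := mul_comm _ _
  smul_def' r x := by
    ext
    rw [val_smul, val_mul, Algebra.smul_def]
    rfl

theorem away_algebraMap_eq :
    algebraMap k (Away 𝒜 f) = (fromZeroRingHom 𝒜 _).comp (algebraMap k (𝒜 0)) :=
  rfl

variable (hf : f ∈ 𝒜 1)

/-- The dehomogenization of a graded algebra at an element `f` of degree one: it sends an element
`a` of degree `d` to `a / f ^ d`. -/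
def dehomogenize : A →ₐ[k] Away 𝒜 f :=
  (DirectSum.toAlgebra k (fun d => 𝒜 d)
    (fun d =>
      { toFun a := Away.mk 𝒜 hf d a (by simp)
        map_add' a b := by
          ext
          simp [Away.val_mk, Localization.add_mk_self]
        map_smul' r a := by
          ext
          simp [Away.val_mk, Localization.smul_mk] })
    (by
      ext
      simp [Away.val_mk])
    (by
      intro i j a b
      ext
      simp [Away.val_mk, Localization.mk_mul, pow_add])).comp
    (DirectSum.decomposeAlgEquiv 𝒜).toAlgHom

theorem dehomogenize_of_mem {d : ℕ} {a : A} (ha : a ∈ 𝒜 d) :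
    dehomogenize 𝒜 hf a = Away.mk 𝒜 hf d a (by simpa using ha) := by
  have h : DirectSum.decomposeAlgEquiv 𝒜 a = DirectSum.of (fun i => 𝒜 i) d ⟨a, ha⟩ :=
    DirectSum.decompose_of_mem 𝒜 ha
  rw [dehomogenize, AlgHom.comp_apply]
  erw [h, DirectSum.toAlgebra_apply, DirectSum.toSemiring_of]
  rfl

theorem dehomogenize_self : dehomogenize 𝒜 hf f = 1 := by
  rw [dehomogenize_of_mem 𝒜 hf hf]
  ext
  simp [Away.val_mk]

theorem dehomogenize_surjective : Function.Surjective (dehomogenize 𝒜 hf) := fun x => by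
  obtain ⟨d, a, ha, rfl⟩ := Away.mk_surjective 𝒜 hf x
  exact ⟨a, dehomogenize_of_mem 𝒜 hf (by simpa using ha)⟩

theorem exists_algHom_comp_dehomogenize_eq {C : Type*} [CommRing C] [Algebra k C] (ψ : A →ₐ[k] C)
    (hψ : ψ f = 1) : ∃ φ : Away 𝒜 f →ₐ[k] C, φ.comp (dehomogenize 𝒜 hf) = ψ := by
  have hu : IsUnit ((ψ : A →+* C) f) := hψ ▸ isUnit_one
  let θ : Localization.Away f →+* C := IsLocalization.Away.lift f hu
  have hθ (a : A) : θ (algebraMap A _ a) = ψ a := IsLocalization.Away.lift_eq f hu a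
  let φ : Away 𝒜 f →+* C := θ.comp (algebraMap (Away 𝒜 f) (Localization.Away f))
  have hφ (a : A) : φ (dehomogenize 𝒜 hf a) = ψ a := by
    induction a using DirectSum.Decomposition.inductionOn 𝒜 with
    | zero => simp only [map_zero]
    | add a b ha hb => rw [map_add, map_add, ha, hb, map_add]
    | @homogeneous d a =>
      have hmk : Localization.mk (a : A) (⟨f ^ d, d, rfl⟩ : Submonoid.powers f) *
          algebraMap A _ f ^ d = algebraMap A _ (a : A) := by
        rw [← map_pow, Localization.mk_eq_mk']
        exact IsLocalization.mk'_spec _ _ _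
      have h := congrArg θ hmk
      rw [map_mul, map_pow, hθ, hθ, hψ, one_pow, mul_one] at h
      rw [dehomogenize_of_mem 𝒜 hf a.2]
      exact h
  refine ⟨{ φ with commutes' := fun r => ?_ }, AlgHom.ext hφ⟩
  rw [← (dehomogenize 𝒜 hf).commutes r, ← ψ.commutes r]
  exact hφ _

theorem ker_dehomogenize : RingHom.ker (dehomogenize 𝒜 hf) = Ideal.span {f - 1} := by
  refine le_antisymm (fun a ha => ?_) ?_
  · obtain ⟨φ, hφ⟩ := exists_algHom_comp_dehomogenize_eq 𝒜 hf
      (Ideal.Quotient.mkₐ k (Ideal.span {f - 1})) (by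
        rw [← map_one (Ideal.Quotient.mkₐ k _), Ideal.Quotient.mkₐ_eq_mk,
          Ideal.Quotient.mk_eq_mk_iff_sub_mem]
        exact Ideal.mem_span_singleton_self _)
    rw [← Ideal.Quotient.eq_zero_iff_mem, ← Ideal.Quotient.mkₐ_eq_mk k, ← hφ, AlgHom.comp_apply,
      RingHom.mem_ker.1 ha, map_zero]
  · rw [Ideal.span_singleton_le_iff_mem, RingHom.mem_ker, map_sub, dehomogenize_self, map_one,
      sub_self]

include hf in
theorem finitePresentation_away_of_mem_one [Algebra.FinitePresentation k A] :
    Algebra.FinitePresentation k (Away 𝒜 f) :=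
  Algebra.FinitePresentation.of_surjective (dehomogenize_surjective 𝒜 hf)
    (ker_dehomogenize 𝒜 hf ▸ ⟨{f - 1}, by simp⟩)

end Dehomogenize

/-! ## Diagonal hypersurfaces -/

section DiagonalForm

variable {k : Type*} [CommRing k] {σ : Type*} [Fintype σ] (m : ℕ) (c : σ → k)

/-- The diagonal form of degree `m` with coefficients `c`. -/
def diagonalForm : MvPolynomial σ k :=
  ∑ i, MvPolynomial.C (c i) * MvPolynomial.X i ^ m

theorem aeval_diagonalForm {C : Type*} [CommRing C] [Algebra k C] (a : σ → C) :
    MvPolynomial.aeval a (diagonalForm m c) = ∑ i, algebraMap k C (c i) * a i ^ m := by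
  simp [diagonalForm]

theorem exists_sub_mem_and_sum_mul_pow_eq_zero {C : Type*} [CommRing C] {J : Ideal C}
    (hJ : J ^ 2 = ⊥) {m : ℕ} {c a : σ → C} {i : σ} (hi : a i = 1)
    (ha : ∑ j, c j * a j ^ m ∈ J) (hu : IsUnit (m * c i)) :
    ∃ b : σ → C, b i = 1 ∧ (∀ j, b j - a j ∈ J) ∧ ∑ j, c j * b j ^ m = 0 := by
  classical
  obtain ⟨u, hu⟩ := hu
  set r := ∑ j, c j * a j ^ m with hr
  -- As the form is homogeneous, multiplying all coordinates but the `i`-th by `1 + t` changes its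
  -- value by `m * t * (r - c i) = -m * t * c i`, which cancels `r`.
  let t := r * (u⁻¹ : Cˣ)
  have hut : m * c i * t = r := by rw [← hu, mul_left_comm, Units.mul_inv, mul_one]
  have ht : t ∈ J := J.mul_mem_right _ ha
  have mul_eq_zero_of_mem {x y : C} (hx : x ∈ J) (hy : y ∈ J) : x * y = 0 := by
    rw [← Ideal.mem_bot, ← hJ, sq]
    exact Ideal.mul_mem_mul hx hy
  have hpow : (1 + t) ^ m = 1 + m * t := by
    obtain ⟨q, hq⟩ := Polynomial.powAddExpansion 1 t m
    rw [hq, sq, mul_eq_zero_of_mem ht ht, mul_zero, add_zero, one_pow, one_pow, mul_one]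
  refine ⟨Function.update (fun j => (1 + t) * a j) i 1, Function.update_self .., fun j => ?_, ?_⟩
  · obtain rfl | hj := eq_or_ne j i
    · rw [Function.update_self, hi, sub_self]
      exact J.zero_mem
    · rw [Function.update_of_ne hj, add_mul, one_mul, add_sub_cancel_left]
      exact J.mul_mem_right _ ht
  · have hsum : ∑ j ∈ Finset.univ.erase i, c j * a j ^ m = r - c i := by
      rw [hr, ← Finset.add_sum_erase _ _ (Finset.mem_univ i), hi, one_pow, mul_one,
        add_sub_cancel_left]
    calc ∑ j, c j * Function.update (fun j => (1 + t) * a j) i 1 j ^ m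
        = c i + ∑ j ∈ Finset.univ.erase i, (1 + t) ^ m * (c j * a j ^ m) := by
          rw [← Finset.add_sum_erase _ _ (Finset.mem_univ i), Function.update_self, one_pow,
            mul_one]
          refine congrArg _ (Finset.sum_congr rfl fun j hj => ?_)
          rw [Function.update_of_ne (Finset.ne_of_mem_erase hj), mul_pow, mul_left_comm]
      _ = c i + (1 + m * t) * (r - c i) := by rw [← Finset.mul_sum, hsum, hpow]
      _ = 0 := by linear_combination m * mul_eq_zero_of_mem ht ha - hut

end DiagonalForm

attribute [local instance] MvPolynomial.gradedAlgebra

section Coordinates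

variable {k : Type u} [CommRing k] {σ : Type}
  (I : HomogeneousIdeal (MvPolynomial.homogeneousSubmodule σ k))

/-- The grading on the homogeneous coordinate ring of `V₊(I)`. -/
abbrev coordinateGrading : ℕ → Submodule k (MvPolynomial σ k ⧸ I.toIdeal) :=
  quotientGrading (MvPolynomial.homogeneousSubmodule σ k) I

/-- The homogeneous coordinates on `V₊(I)`. -/
def homogeneousCoordinate (j : σ) : MvPolynomial σ k ⧸ I.toIdeal :=
  Ideal.Quotient.mk _ (MvPolynomial.X j)

theorem homogeneousCoordinate_mem (j : σ) : homogeneousCoordinate I j ∈ coordinateGrading I 1 :=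
  ⟨_, MvPolynomial.isHomogeneous_X k j, rfl⟩

/-- The coordinate ring of the chart of `V₊(I)` on which the `i`-th coordinate does not vanish. -/
abbrev CoordinateChart (i : σ) : Type u :=
  Away (coordinateGrading I) (homogeneousCoordinate I i)

/-- The affine coordinates `x_j / x_i` on the `i`-th chart of `V₊(I)`. -/
def affineCoordinate (i j : σ) : CoordinateChart I i :=
  dehomogenize (coordinateGrading I) (homogeneousCoordinate_mem I i) (homogeneousCoordinate I j)

theorem affineCoordinate_self (i : σ) : affineCoordinate I i i = 1 :=
  dehomogenize_self _ _

theorem aeval_affineCoordinate (i : σ) :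
    MvPolynomial.aeval (affineCoordinate I i) =
      (dehomogenize (coordinateGrading I) (homogeneousCoordinate_mem I i)).comp
        (Ideal.Quotient.mkₐ k I.toIdeal) :=
  MvPolynomial.algHom_ext fun j => MvPolynomial.aeval_X _ j

variable {I} in
theorem aeval_affineCoordinate_eq_zero (i : σ) {F : MvPolynomial σ k} (hF : F ∈ I) :
    MvPolynomial.aeval (affineCoordinate I i) F = 0 := by
  rw [aeval_affineCoordinate, AlgHom.comp_apply, Ideal.Quotient.mkₐ_eq_mk,
    Ideal.Quotient.eq_zero_iff_mem.2 hF, map_zero]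

variable {I} {i : σ} {C : Type*} [CommRing C] [Algebra k C]

theorem coordinateChart_algHom_ext {φ ψ : CoordinateChart I i →ₐ[k] C}
    (h : ∀ j, φ (affineCoordinate I i j) = ψ (affineCoordinate I i j)) : φ = ψ := by
  refine (AlgHom.cancel_right (dehomogenize_surjective (coordinateGrading I)
    (homogeneousCoordinate_mem I i))).1 (Ideal.Quotient.algHom_ext _ ?_)
  exact MvPolynomial.algHom_ext h

theorem exists_coordinateChart_algHom (a : σ → C) (hi : a i = 1)
    (ha : ∀ F ∈ I, MvPolynomial.aeval a F = 0) :
    ∃ φ : CoordinateChart I i →ₐ[k] C, ∀ j, φ (affineCoordinate I i j) = a j := by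
  let ψ : MvPolynomial σ k ⧸ I.toIdeal →ₐ[k] C := Ideal.Quotient.liftₐ _ (MvPolynomial.aeval a) ha
  have hψ (j : σ) : ψ (homogeneousCoordinate I j) = a j := MvPolynomial.aeval_X a j
  obtain ⟨φ, hφ⟩ := exists_algHom_comp_dehomogenize_eq (coordinateGrading I)
    (homogeneousCoordinate_mem I i) ψ ((hψ i).trans hi)
  exact ⟨φ, fun j => (DFunLike.congr_fun hφ _).trans (hψ j)⟩

variable (I) in
theorem iSup_basicOpen_homogeneousCoordinate :
    ⨆ j, Proj.basicOpen (coordinateGrading I) (homogeneousCoordinate I j) = ⊤ := by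
  refine Proj.iSup_basicOpen_eq_top' _ _ (fun j => ⟨1, homogeneousCoordinate_mem I j⟩)
    (top_le_iff.1 fun x _ => ?_)
  obtain ⟨F, rfl⟩ := Ideal.Quotient.mk_surjective x
  induction F using MvPolynomial.induction_on with
  | C r => exact Subalgebra.algebraMap_mem _ (algebraMap k (coordinateGrading I 0) r)
  | add p q hp hq =>
    rw [map_add]
    exact add_mem (hp trivial) (hq trivial)
  | mul_X p j hp =>
    rw [map_mul]
    exact mul_mem (hp trivial) (Algebra.subset_adjoin ⟨j, rfl⟩)

end Coordinates

section DiagonalHypersurface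

variable {k : Type u} [CommRing k] {σ : Type} [Fintype σ]
  {I : HomogeneousIdeal (MvPolynomial.homogeneousSubmodule σ k)} {m : ℕ} {c : σ → k}
  (hI : I.toIdeal = Ideal.span {diagonalForm m c})

include hI

theorem sum_affineCoordinate_pow (i : σ) :
    ∑ j, algebraMap k (CoordinateChart I i) (c j) * affineCoordinate I i j ^ m = 0 := by
  have hF : diagonalForm m c ∈ I.toIdeal := hI ▸ Ideal.mem_span_singleton_self _
  rw [← aeval_diagonalForm, aeval_affineCoordinate_eq_zero i hF]

theorem exists_coordinateChart_algHom_of_sum {C : Type*} [CommRing C] [Algebra k C] {i : σ}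
    (a : σ → C) (hi : a i = 1) (ha : ∑ j, algebraMap k C (c j) * a j ^ m = 0) :
    ∃ φ : CoordinateChart I i →ₐ[k] C, ∀ j, φ (affineCoordinate I i j) = a j := by
  refine exists_coordinateChart_algHom a hi fun F hF => ?_
  obtain ⟨q, rfl⟩ := Ideal.mem_span_singleton.1 (hI ▸ hF : F ∈ Ideal.span {diagonalForm m c})
  rw [map_mul, aeval_diagonalForm, ha, zero_mul]

theorem formallySmooth_coordinateChart {i : σ} (hu : IsUnit (m * c i)) :
    Algebra.FormallySmooth k (CoordinateChart I i) := by
  refine Algebra.FormallySmooth.of_comp_surjective fun C _ _ J hJ φ => ?_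
  obtain ⟨a, hai, ha⟩ : ∃ a : σ → C, a i = 1 ∧
      ∀ j, Ideal.Quotient.mk J (a j) = φ (affineCoordinate I i j) := by
    classical
    choose a ha using fun j => Ideal.Quotient.mk_surjective (φ (affineCoordinate I i j))
    refine ⟨Function.update a i 1, Function.update_self .., fun j => ?_⟩
    obtain rfl | hj := eq_or_ne j i
    · rw [Function.update_self, affineCoordinate_self, map_one, map_one]
    · rw [Function.update_of_ne hj, ha]
  have haJ : ∑ j, algebraMap k C (c j) * a j ^ m ∈ J := by
    rw [← Ideal.Quotient.eq_zero_iff_mem, ← map_zero φ, ← sum_affineCoordinate_pow hI i]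
    simp only [map_sum, map_mul, map_pow, ha, Ideal.Quotient.mk_algebraMap, AlgHom.commutes]
  obtain ⟨b, hbi, hba, hb⟩ := exists_sub_mem_and_sum_mul_pow_eq_zero hJ hai haJ
    (by simpa using hu.map (algebraMap k C))
  obtain ⟨ψ, hψ⟩ := exists_coordinateChart_algHom_of_sum hI b hbi hb
  refine ⟨ψ, coordinateChart_algHom_ext fun j => ?_⟩
  rw [AlgHom.comp_apply, hψ, ← ha, Ideal.Quotient.mkₐ_eq_mk, Ideal.Quotient.mk_eq_mk_iff_sub_mem]
  exact hba j

theorem smooth_coordinateChart {i : σ} (hu : IsUnit (m * c i)) :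
    Algebra.Smooth k (CoordinateChart I i) where
  formallySmooth := formallySmooth_coordinateChart hI hu
  finitePresentation := by
    have : Algebra.FinitePresentation k (MvPolynomial σ k ⧸ I.toIdeal) :=
      Algebra.FinitePresentation.quotient (hI ▸ ⟨{diagonalForm m c}, by simp⟩)
    exact finitePresentation_away_of_mem_one _ (homogeneousCoordinate_mem I i)

end DiagonalHypersurface

/-! ## Projective schemes over a ring -/

section ProjToSpec

variable {k A : Type u} [CommRing k] [CommRing A] [Algebra k A] (𝒜 : ℕ → Submodule k A)
  [GradedAlgebra 𝒜]

/-- The structure morphism of `Proj 𝒜` over the base ring. -/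
def projToSpec : Proj 𝒜 ⟶ Spec (CommRingCat.of k) :=
  Proj.toSpecZero 𝒜 ≫ Spec.map (CommRingCat.ofHom (algebraMap k (𝒜 0)))

theorem awayι_projToSpec {d : ℕ} {f : A} (hf : f ∈ 𝒜 d) (hd : 0 < d) :
    Proj.awayι 𝒜 f hf hd ≫ projToSpec 𝒜 =
      Spec.map (CommRingCat.ofHom (algebraMap k (Away 𝒜 f))) := by
  rw [projToSpec, Proj.awayι_toSpecZero_assoc, ← Spec.map_comp, away_algebraMap_eq,
    CommRingCat.ofHom_comp]

variable {𝒜} {ι : Type*} {x : ι → A} (hcover : ⨆ i, Proj.basicOpen 𝒜 (x i) = ⊤) {d : ι → ℕ}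
  (hx : ∀ i, x i ∈ 𝒜 (d i)) (hd : ∀ i, 0 < d i)

include hcover hx hd

theorem smooth_projToSpec_of_smooth_away (h : ∀ i, Algebra.Smooth k (Away 𝒜 (x i))) :
    Smooth (projToSpec 𝒜) := by
  have : IsZariskiLocalAtSource @Smooth.{u} :=
    HasRingHomProperty.instIsZariskiLocalAtSource (Q := RingHom.Smooth)
  refine (IsZariskiLocalAtSource.iff_of_iSup_eq_top (P := @Smooth.{u}) _ hcover).2 fun i => ?_
  have hι : (Proj.basicOpen 𝒜 (x i)).ι ≫ projToSpec 𝒜 =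
      (Proj.basicOpenIsoSpec 𝒜 (x i) (hx i) (hd i)).hom ≫
        Spec.map (CommRingCat.ofHom (algebraMap k (Away 𝒜 (x i)))) := by
    rw [← awayι_projToSpec 𝒜 (hx i) (hd i), ← Proj.basicOpenIsoSpec_inv_ι, Category.assoc,
      Iso.hom_inv_id_assoc]
  have hsmooth : Smooth (Spec.map (CommRingCat.ofHom (algebraMap k (Away 𝒜 (x i))))) := by
    rw [HasRingHomProperty.Spec_iff (P := @Smooth), CommRingCat.hom_ofHom,
      RingHom.smooth_algebraMap]
    exact h i
  exact hι ▸ smooth_comp _ _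

theorem exists_ringHom_away_of_spec_hom {R : CommRingCat.{u}} [IsLocalRing R]
    (g : Spec R ⟶ Proj 𝒜) {θ : k →+* R}
    (hg : g ≫ projToSpec 𝒜 = Spec.map (CommRingCat.ofHom θ)) :
    ∃ (i : ι) (φ : Away 𝒜 (x i) →+* R), φ.comp (algebraMap k (Away 𝒜 (x i))) = θ := by
  obtain ⟨i, hi⟩ := TopologicalSpace.Opens.mem_iSup.1
    (hcover ▸ TopologicalSpace.Opens.mem_top (g (IsLocalRing.closedPoint R)))
  let α := Proj.awayι 𝒜 (x i) (hx i) (hd i)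
  have hrange : Set.range g ⊆ Set.range α := by
    have htop : g ⁻¹ᵁ Proj.basicOpen 𝒜 (x i) = ⊤ :=
      Scheme.preimage_eq_top_of_closedPoint_mem g hi
    rintro _ ⟨z, rfl⟩
    have hz : z ∈ g ⁻¹ᵁ Proj.basicOpen 𝒜 (x i) := htop ▸ TopologicalSpace.Opens.mem_top z
    rwa [← Proj.opensRange_awayι 𝒜 (x i) (hx i) (hd i)] at hz
  let φ := Spec.preimage (IsOpenImmersion.lift α g hrange)
  have hφ : Spec.map φ ≫ α = g := by rw [Spec.map_preimage, IsOpenImmersion.lift_fac]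
  refine ⟨i, φ.hom, ?_⟩
  rw [← hφ, Category.assoc, awayι_projToSpec, ← Spec.map_comp] at hg
  exact congrArg CommRingCat.Hom.hom (Spec.map_injective hg)

end ProjToSpec

section DiagonalHypersurface

variable {k : Type u} [CommRing k] {σ : Type} [Fintype σ]
  {I : HomogeneousIdeal (MvPolynomial.homogeneousSubmodule σ k)} {m : ℕ} {c : σ → k}
  (hI : I.toIdeal = Ideal.span {diagonalForm m c})

include hI

theorem smooth_projToSpec_of_diagonalForm (hu : ∀ i, IsUnit (m * c i)) :
    Smooth (projToSpec (coordinateGrading I)) :=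
  smooth_projToSpec_of_smooth_away (iSup_basicOpen_homogeneousCoordinate I)
    (homogeneousCoordinate_mem I) (fun _ => one_pos) fun i => smooth_coordinateChart hI (hu i)

theorem exists_sum_mul_pow_eq_zero_of_spec_hom {R : CommRingCat.{u}} [IsLocalRing R]
    (g : Spec R ⟶ Proj (coordinateGrading I)) {θ : k →+* R}
    (hg : g ≫ projToSpec (coordinateGrading I) = Spec.map (CommRingCat.ofHom θ)) :
    ∃ y : σ → R, (∃ i, y i = 1) ∧ ∑ j, θ (c j) * y j ^ m = 0 := by
  obtain ⟨i, φ, rfl⟩ := exists_ringHom_away_of_spec_hom (iSup_basicOpen_homogeneousCoordinate I)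
    (homogeneousCoordinate_mem I) (fun _ => one_pos) g hg
  refine ⟨fun j => φ (affineCoordinate I i j), ⟨i, ?_⟩, ?_⟩
  · simp only [affineCoordinate_self, map_one]
  · simpa using congrArg φ (sum_affineCoordinate_pow hI i)

end DiagonalHypersurface

theorem fromSpecStalk_genericPoint_comp {L : Type u} [Field L] {Y : Scheme.{u}}
    [IrreducibleSpace Y] (f : Y ⟶ Spec (CommRingCat.of L)) :
    Y.fromSpecStalk (genericPoint Y) ≫ f = Spec.map (CommRingCat.ofHom (toFunctionField f)) := by
  have h : f = Y.toSpecΓ ≫ Spec.map ((Scheme.ΓSpecIso (CommRingCat.of L)).inv ≫ f.appTop) := by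
    rw [Spec.map_comp, ← Scheme.toSpecΓ_naturality_assoc, toSpecΓ_SpecMap_ΓSpecIso_inv,
      Category.comp_id]
  conv_lhs => rw [h]
  rw [Scheme.fromSpecStalk_toSpecΓ_assoc, ← Spec.map_comp, toFunctionField]
  rfl

/-! ## Fermat–Pfister hypersurfaces -/

section FermatPfister

variable {L : Type u} [Field L] {m n : ℕ} {χ : Fin n → Lˣ}

/-- The coefficients of the Fermat–Pfister form, indexed by `φ ε = ∑ i, ε i * 2 ^ i`. -/
def fermatPfisterCoeff (χ : Fin n → Lˣ) (j : Fin (2 ^ n)) : L :=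
  ∏ i, (-(χ i : L)) ^ (finFunctionFinEquiv.symm j i : ℕ)

theorem fermatPfisterCoeff_ne_zero (j : Fin (2 ^ n)) : fermatPfisterCoeff χ j ≠ 0 :=
  Finset.prod_ne_zero_iff.2 fun i _ => pow_ne_zero _ (neg_ne_zero.2 (χ i).ne_zero)

theorem fermatPfisterForm_eq_diagonalForm :
    fermatPfisterForm m n χ = diagonalForm m (fermatPfisterCoeff χ) := by
  rw [diagonalForm, ← finFunctionFinEquiv.sum_comp]
  simp only [fermatPfisterCoeff, Equiv.symm_apply_apply]
  rfl

variable (m n χ) in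
theorem fermatPfisterIdeal_toIdeal :
    (fermatPfisterIdeal m n χ).toIdeal = Ideal.span {diagonalForm m (fermatPfisterCoeff χ)} :=
  congrArg (fun F => Ideal.span {F}) fermatPfisterForm_eq_diagonalForm

theorem smooth_fermatPfisterHypersurface_toSpec (hm : IsUnit (m : L)) :
    Smooth (fermatPfisterHypersurface.toSpec m n χ) :=
  smooth_projToSpec_of_diagonalForm (fermatPfisterIdeal_toIdeal m n χ) fun j =>
    hm.mul (fermatPfisterCoeff_ne_zero j).isUnit

theorem fermatPfisterValue_map {R : Type*} [CommRing R] (θ : L →+* R) (y : Fin (2 ^ n) → R) :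
    fermatPfisterValue m (fun i => Units.map (θ : L →* R) (χ i))
        (fun ε => y (finFunctionFinEquiv ε)) =
      ∑ j, θ (fermatPfisterCoeff χ j) * y j ^ m := by
  rw [← finFunctionFinEquiv.sum_comp]
  simp [fermatPfisterValue, fermatPfisterCoeff]

theorem milnorSymbol_mem_ker_functionField (hm : m ≠ 0) {Y : Scheme.{u}} [IsIntegral Y]
    (ι : Y ⟶ fermatPfisterHypersurface m n χ) :
    milnorSymbol m χ ∈ LinearMap.ker
      (milnorKModMap (toFunctionField (ι ≫ fermatPfisterHypersurface.toSpec m n χ)) n m) := by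
  have hg := fromSpecStalk_genericPoint_comp (ι ≫ fermatPfisterHypersurface.toSpec m n χ)
  rw [← Category.assoc] at hg
  obtain ⟨y, ⟨i, hi⟩, hy⟩ :=
    exists_sum_mul_pow_eq_zero_of_spec_hom (fermatPfisterIdeal_toIdeal m n χ) _ hg
  rw [LinearMap.mem_ker, milnorKModMap_symbol]
  refine milnorSymbol_eq_zero_of_fermatPfisterValue_eq_zero hm _
    (y := fun ε => y (finFunctionFinEquiv ε)) ?_ ?_
  · exact Function.ne_iff.2 ⟨finFunctionFinEquiv.symm i, by simp [hi]⟩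
  · exact (fermatPfisterValue_map _ y).trans hy

end FermatPfister

end

theorem corollary4p3_general {L : Type u} [Field L] (m n : ℕ) (χ : Fin n → Lˣ) :
    (IsUnit (m : L) → Smooth (fermatPfisterHypersurface.toSpec m n χ)) ∧
    (m ≠ 0 → ∀ (Y : Scheme.{u}) [IsIntegral Y] (ι : Y ⟶ fermatPfisterHypersurface m n χ),
      milnorSymbol m χ ∈ LinearMap.ker
        (milnorKModMap (toFunctionField (ι ≫ fermatPfisterHypersurface.toSpec m n χ)) n m)) :=
  ⟨smooth_fermatPfisterHypersurface_toSpec, fun hm _ _ ι => milnorSymbol_mem_ker_functionField hm ι⟩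

theorem corollary4p3 {L : Type u} [Field L] (m n : ℕ) (hm : 2 ≤ m) (hn : 2 ≤ n)
    (hmL : IsUnit (m : L)) (χ : Fin n → Lˣ) :
    Smooth (fermatPfisterHypersurface.toSpec m n χ) ∧
    ∀ (Y : Scheme.{u}) (f : Y ⟶ Spec (CommRingCat.of L))
      [IsIntegral Y] [IsSeparated f] [LocallyOfFiniteType f] [QuasiCompact f]
      (ι : Y ⟶ fermatPfisterHypersurface m n χ),
      ι ≫ fermatPfisterHypersurface.toSpec m n χ = f →
        milnorSymbol m χ ∈ LinearMap.ker (milnorKModMap (toFunctionField f) n m) :=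
  ⟨(corollary4p3_general m n χ).1 hmL, fun Y _ _ _ _ _ ι h =>
    h ▸ (corollary4p3_general m n χ).2 (by omega) Y ι⟩
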